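/- **Conventions.** For $\gamma>0$ let $PW_\gamma$ be the space of all $f\in L^2(\mathbb R)$ whose Fourier transform $\hat f(\xi)=\int_{\mathbb R} f(x)e^{-ix\xi}\,dx$ (in the $L^2$ sense) vanishes for almost every $\xi\notin[-\gamma,\gamma]$; each $f\in PW_\gamma$ is identified with its continuous representative, which extends to an entire function, and $f^\sharp(z)=\overline{f(\bar z)}$, so that $f^\sharp=\overline f$ on $\mathbb R$. For $f,g\in PW_\gamma$ write $f\sim g$ if $f=\lambda g$ or $f=\lambda g^\sharp$ for some $\lambda\in\mathbb C$ with $|\lambda|=1$. A sequence $\{t_n\}_{n\in\mathbb Z}\subset\mathbb R$ is a set of sampling for $PW_\gamma$ if there are constants $A,B>0$ with $A\|f\|_{L^2}^2\le\sum_n|f(t_n)|^2\le B\|f\|_{L^2}^2$ for all $f\in PW_\gamma$. A $K\times M$ complex matrix $V$ with columns $\vec v_0,\dots,\vec v_{M-1}$ does conjugate phase retrieval on $\mathbb C^K$ if, for $\vec x,\vec y\in\mathbb C^K$, the equalities $|\langle\vec x,\vec v_m\rangle|=|\langle\vec y,\vec v_m\rangle|$ for all $m$ imply that $\vec x=e^{i\theta}\vec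 y$ or $\vec x=e^{i\theta}\overline{\vec y}$ for some $\theta\in\mathbb R$. The Beurling density of $X\subseteq\mathbb R$ is $\mathcal D(X)=\lim_{h\to\infty}\inf_{x\in\mathbb R}\#(X\cap[x,x+h])/h\in[0,\infty]$, if this limit exists. For shifts $b_0,\dots,b_{K-1}\in\mathbb R$, a vector $\vec v=(v_0,\dots,v_{K-1})\in\mathbb C^K$ and $f\in PW_\pi$, the structured convolution is $(\vec v*f)(t)=\sum_{k=0}^{K-1}\overline{v_k}\,f(t+b_k)$. **Theorem.** Let $V=[\vec v_0\ \cdots\ \vec v_{M-1}]$ be a $K\times M$ matrix which does conjugate phase retrieval on $\mathbb C^K$. Let $b_0,\dots,b_{K-1}\in\mathbb R$ be such that the subgroup of $\mathbb R$ generated by the differences $b_j-b_k$, $0\le j,k\le K-1$, has Beurling density greater than $1$ (possibly $\infty$); if $b_0=0$ this is the subgroup generated by $b_0,\dots,b_{K-1}$. Let $\{t_n\}_{n\in\mathbb Z}\subset\mathbb R$ be a set of sampling for $PW_{2\pi}$. Then, for all $f,g\in PW_\pi$, if $$|(\vec v_m*f)(t_n)|=|(\vec v_m*g)(t_n)|\qquad\text{for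 all } m=0,\dots,M-1,\ n\in\mathbb Z,$$ then $f\sim g$. -/

import Mathlib

open MeasureTheory Filter Topology
open scoped FourierTransform ComplexConjugate ENNReal

noncomputable section

/-- The Paley-Wiener space `PW_γ`: square integrable functions on the line whose Fourier transform
vanishes almost everywhere outside `[-γ, γ]`, each class being represented by its (unique)
continuous representative, so that point values make sense.
Here the Fourier transform is `f̂ (ω) = ∫ f x * exp (-i ω x) dx`; Mathlib's `𝓕` has the kernel
`exp (-2 π i ξ x)`, so the frequency is `ω = 2 π ξ`. -/
def PaleyWiener (γ : ℝ) : Set (ℝ → ℂ) :=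
  {f | Continuous f ∧ ∃ hf : MemLp f 2 (volume : Measure ℝ),
    ∀ᵐ ξ : ℝ, 2 * Real.pi * ξ ∉ Set.Icc (-γ) γ →
      (𝓕 (hf.toLp f) : Lp ℂ 2 (volume : Measure ℝ)) ξ = 0}

/-- `f ~ g`: `f = c g` or `f = c g♯` for a unimodular constant `c`, where `g♯` is the function
`z ↦ conj (g (conj z))`, which on the real line is the complex conjugate of `g`. -/
def ConjEquiv (f g : ℝ → ℂ) : Prop :=
  ∃ c : ℂ, ‖c‖ = 1 ∧ ((∀ x, f x = c * g x) ∨ (∀ x, f x = c * conj (g x)))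

/-- The sequence `t` is a set of sampling for `PW_γ`. -/
def IsSetOfSampling (γ : ℝ) (t : ℤ → ℝ) : Prop :=
  ∃ A B : ℝ, 0 < A ∧ 0 < B ∧ ∀ f ∈ PaleyWiener γ,
    Summable (fun n => ‖f (t n)‖ ^ 2) ∧
    A * ∫ x, ‖f x‖ ^ 2 ≤ ∑' n, ‖f (t n)‖ ^ 2 ∧
    ∑' n, ‖f (t n)‖ ^ 2 ≤ B * ∫ x, ‖f x‖ ^ 2

/-- The columns of the `K × M` matrix `V` do conjugate phase retrieval on `ℂ^K`. -/
def DoesConjPhaseRetrieval {K M : ℕ} (V : Matrix (Fin K) (Fin M) ℂ) : Prop :=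
  ∀ x y : Fin K → ℂ,
    (∀ m, ‖∑ k, conj (V k m) * x k‖ = ‖∑ k, conj (V k m) * y k‖) →
    ∃ θ : ℝ, (∀ k, x k = Complex.exp (θ * Complex.I) * y k) ∨
      (∀ k, x k = Complex.exp (θ * Complex.I) * conj (y k))

/-- The structured convolution `v ∗ f = ∑ k, conj (v k) f (· + b k)`. -/
def structuredConv {K : ℕ} (b : Fin K → ℝ) (v : Fin K → ℂ) (f : ℝ → ℂ) (t : ℝ) : ℂ :=
  ∑ k, conj (v k) * f (t + b k)

/-- The subset `X` of the line has Beurling density `D`, where `D = ∞` is allowed: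
`inf_x #(X ∩ [x, x + h]) / h` tends to `D` as `h → ∞`. -/
def HasBeurlingDensity (X : Set ℝ) (D : ℝ≥0∞) : Prop :=
  Tendsto (fun h : ℝ => (⨅ x : ℝ, ((X ∩ Set.Icc x (x + h)).encard : ℝ≥0∞)) / ENNReal.ofReal h)
    atTop (𝓝 D)

end

/-!
If `|v_m ∗ f|` and `|v_m ∗ g|` agree on a sampling set for `PW_{2π}`, they agree on the whole line,
because the difference of their squares lies in `PW_{2π}` (`norm_eq_of_norm_eq_on_sampling`).
Conjugate phase retrieval on `ℂ^K` then says that for each real `x` the vector `(f (x + b_k))_k`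
equals, up to phase, the vector `(g (x + b_k))_k` or its conjugate. Passing to the products
`f (x + b_j) conj (f (x + b_k))`, which are real-analytic and do not see the phase, one of the two
alternatives holds for all `x` (`translate_products_dichotomy`); replacing `g` by its conjugate,
suppose it is the first one.

Then `f / g` is unimodular and invariant under every difference `b_j - b_k`
(`cross_mul_eq_of_products_eq`), hence, by analyticity, under the group they generate
(`quotientPeriods`). That group has density greater than `1`, so it contains some `a ∈ (0, 1)`
(`exists_mem_Ioo_of_one_lt_density`). No study of the zeros of `g` is needed to conclude: fix `x₀`
with `g x₀ ≠ 0`. The function `g x₀ * f - f x₀ * g` lies in `PW_π` and vanishes on `x₀ + aℤ`, a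
progression above the Nyquist rate, so it is zero (`eq_zero_of_eq_zero_on_int_mul`), and `f` is a
unimodular multiple of `g`.

The facts used about `PW_γ` all follow from its description as the set of inverse Fourier integrals
of square integrable functions supported in a fixed interval (`mem_paleyWiener_iff`). This rests on
comparing the `L²` Fourier transform, defined by extension from Schwartz functions, with the Fourier
integral on `L¹ ∩ L²`.
-/

/-! ### Integral representation of Paley-Wiener functions -/

/-- `φ` is the spectrum of a function band-limited to `[-r, r]`: square integrable and zero at every
point (not merely almost every point) off `[-r, r]`. The variable is the frequency `ξ` of Mathlib's
Fourier kernel, so `r` corresponds to `γ = 2 π r` in `PaleyWiener γ`. -/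
structure IsSpectrum (r : ℝ) (φ : ℝ → ℂ) : Prop where
  memLp : MemLp φ 2 volume
  eq_zero : ∀ ξ, ξ ∉ Set.Icc (-r) r → φ ξ = 0

theorem IsSpectrum.integrable {r : ℝ} {φ : ℝ → ℂ} (h : IsSpectrum r φ) : Integrable φ := by
  have h1 : MemLp φ 2 (volume.restrict (Set.Icc (-r) r)) := h.memLp.restrict _
  have h2 : IntegrableOn φ (Set.Icc (-r) r) := h1.integrable (by norm_num)
  exact h2.integrable_of_forall_notMem_eq_zero h.eq_zero

theorem continuous_fourierInv {φ : ℝ → ℂ} (h : Integrable φ) : Continuous (𝓕⁻ φ) := by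
  have : (𝓕⁻ φ) = fun x => 𝓕 φ (-x) := by
    ext x; exact Real.fourierInv_eq_fourier_neg φ x
  rw [this]
  exact (VectorFourier.fourierIntegral_continuous Real.continuous_fourierChar (by fun_prop) h).comp
    continuous_neg

/-- The inverse Fourier transform is self-adjoint for the bilinear pairing. -/
theorem integral_schwartz_fourierInv (s : SchwartzMap ℝ ℂ) {φ : ℝ → ℂ} (h : Integrable φ) :
    ∫ x, (𝓕⁻ s) x • φ x = ∫ x, s x • (𝓕⁻ φ) x := by
  have := VectorFourier.integral_fourierIntegral_smul_eq_flip (μ := volume) (ν := volume)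
    (e := Real.fourierChar) (L := -innerₗ ℝ) (f := s) (g := φ) Real.continuous_fourierChar
    (by simp only [LinearMap.neg_apply, innerₗ_apply_apply]; fun_prop) s.integrable h
  have e1 : ∀ x, VectorFourier.fourierIntegral Real.fourierChar volume (-innerₗ ℝ) s x
      = (𝓕⁻ s) x := by
    intro x
    rw [SchwartzMap.fourierInv_coe, Real.fourierInv_eq]
    simp [VectorFourier.fourierIntegral]
  have e2 : ∀ x, VectorFourier.fourierIntegral Real.fourierChar volume (-innerₗ ℝ).flip φ x
      = (𝓕⁻ φ) x := by
    intro x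
    rw [Real.fourierInv_eq]
    simp [VectorFourier.fourierIntegral, mul_comm]
  simpa only [e1, e2] using this

/-- On `L¹ ∩ L²` the inverse Fourier transform defined by extension to `L²` agrees with the one
defined by an integral: both have the same pairing with every test function. -/
theorem fourierInv_toLp_ae_eq {φ : ℝ → ℂ} (h1 : Integrable φ) (h2 : MemLp φ 2 volume) :
    ((𝓕⁻ (h2.toLp φ) : Lp ℂ 2 (volume : Measure ℝ)) : ℝ → ℂ) =ᵐ[volume] 𝓕⁻ φ := by
  refine ae_eq_of_integral_contDiff_smul_eq
    ((Lp.memLp _).locallyIntegrable (by norm_num))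
    (continuous_fourierInv h1).locallyIntegrable ?_
  intro g hg hgs
  let s : SchwartzMap ℝ ℂ := HasCompactSupport.toSchwartzMap (f := fun x => (g x : ℂ))
    (hgs.comp_left Complex.ofReal_zero) (Complex.ofRealCLM.contDiff.comp hg)
  have hs : ∀ x, s x = (g x : ℂ) := fun x => rfl
  have key := congrArg (fun T => T s) (Lp.fourierInv_toTemperedDistribution_eq (h2.toLp φ))
  simp only [TemperedDistribution.fourierInv_apply, Lp.toTemperedDistribution_apply] at key
  have e : ∫ x, (𝓕⁻ s) x • (h2.toLp φ) x = ∫ x, (𝓕⁻ s) x • φ x := by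
    refine integral_congr_ae ?_
    filter_upwards [h2.coeFn_toLp] with x hx
    rw [hx]
  rw [e, integral_schwartz_fourierInv s h1] at key
  simpa [hs] using key.symm

theorem two_pi_mul_notMem_Icc {r ξ : ℝ} :
    2 * Real.pi * ξ ∉ Set.Icc (-(2 * Real.pi * r)) (2 * Real.pi * r) ↔ ξ ∉ Set.Icc (-r) r := by
  have hp : 0 < 2 * Real.pi := by positivity
  rw [not_iff_not, Set.mem_Icc, Set.mem_Icc, ← mul_neg, mul_le_mul_iff_right₀ hp,
    mul_le_mul_iff_right₀ hp]

/-- `PaleyWiener (2 π r)` consists of the absolutely convergent integrals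
`x ↦ ∫ φ ξ exp (2 π i x ξ) dξ` with `φ` in `L²` and supported in `[-r, r]`; the equality holds at
every point because both sides are continuous. -/
theorem mem_paleyWiener_iff {r : ℝ} {f : ℝ → ℂ} :
    f ∈ PaleyWiener (2 * Real.pi * r) ↔ ∃ φ, IsSpectrum r φ ∧ f = 𝓕⁻ φ := by
  constructor
  · rintro ⟨hc, hf, h0⟩
    simp only [two_pi_mul_notMem_Icc] at h0
    set F : Lp ℂ 2 (volume : Measure ℝ) := 𝓕 (hf.toLp f) with hF
    have hφ : IsSpectrum r ((Set.Icc (-r) r).indicator F) :=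
      ⟨(Lp.memLp F).indicator measurableSet_Icc, fun ξ hξ => Set.indicator_of_notMem hξ _⟩
    refine ⟨_, hφ, ?_⟩
    -- Truncation changes the Fourier transform only on a null set.
    have hae : (Set.Icc (-r) r).indicator F =ᵐ[volume] F := by
      filter_upwards [h0] with ξ hξ
      by_cases h : ξ ∈ Set.Icc (-r) r
      · simp [h]
      · simp [h, hξ h]
    have hF' : hφ.memLp.toLp _ = F :=
      (MemLp.toLp_congr _ (Lp.memLp F) hae).trans (Lp.toLp_coeFn F _)
    have h3 := fourierInv_toLp_ae_eq hφ.integrable hφ.memLp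
    rw [hF', hF, FourierTransform.fourierInv_fourier_eq] at h3
    exact ((hc.ae_eq_iff_eq volume (continuous_fourierInv hφ.integrable)).1
      (hf.coeFn_toLp.symm.trans h3))
  · rintro ⟨φ, hφ, rfl⟩
    have h3 := fourierInv_toLp_ae_eq hφ.integrable hφ.memLp
    have hm : MemLp (𝓕⁻ φ) 2 volume := (memLp_congr_ae h3).1 (Lp.memLp _)
    refine ⟨continuous_fourierInv hφ.integrable, hm, ?_⟩
    have : hm.toLp _ = 𝓕⁻ (hφ.memLp.toLp φ) :=
      (MemLp.toLp_congr _ (Lp.memLp _) h3.symm).trans (Lp.toLp_coeFn _ _)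
    rw [this, FourierTransform.fourier_fourierInv_eq]
    filter_upwards [hφ.memLp.coeFn_toLp] with ξ hξ h
    rw [hξ]
    exact hφ.eq_zero ξ (two_pi_mul_notMem_Icc.1 h)

theorem fourierInv_eq_integral_exp (φ : ℝ → ℂ) (x : ℝ) :
    (𝓕⁻ φ) x = ∫ ξ : ℝ, Complex.exp (2 * Real.pi * Complex.I * x * ξ) * φ ξ := by
  rw [Real.fourierInv_eq']
  congr with ξ
  simp only [RCLike.inner_apply, conj_trivial, smul_eq_mul]
  push_cast
  ring_nf

/-! ### Operations on spectra -/

theorem norm_exp_two_pi_mul (x ξ : ℝ) :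
    ‖Complex.exp (2 * Real.pi * Complex.I * x * ξ)‖ = 1 := by
  have : (2 * Real.pi * Complex.I * x * ξ : ℂ) = ((2 * Real.pi * x * ξ : ℝ) : ℂ) * Complex.I := by
    push_cast; ring
  rw [this, Complex.norm_exp_ofReal_mul_I]

theorem integrable_exp_mul {φ : ℝ → ℂ} (h : Integrable φ) (x : ℝ) :
    Integrable fun ξ : ℝ => Complex.exp (2 * Real.pi * Complex.I * x * ξ) * φ ξ :=
  h.bdd_mul (c := 1) (by fun_prop) (ae_of_all _ fun ξ => (norm_exp_two_pi_mul x ξ).le)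

theorem IsSpectrum.add {r : ℝ} {φ ψ : ℝ → ℂ} (h : IsSpectrum r φ) (h' : IsSpectrum r ψ) :
    IsSpectrum r (φ + ψ) :=
  ⟨h.memLp.add h'.memLp, fun ξ hξ => by simp [h.eq_zero ξ hξ, h'.eq_zero ξ hξ]⟩

theorem IsSpectrum.const_mul {r : ℝ} {φ : ℝ → ℂ} (h : IsSpectrum r φ) (c : ℂ) :
    IsSpectrum r (fun ξ => c * φ ξ) :=
  ⟨h.memLp.const_mul c, fun ξ hξ => by simp [h.eq_zero ξ hξ]⟩

theorem IsSpectrum.modulate {r : ℝ} {φ : ℝ → ℂ} (h : IsSpectrum r φ) (b : ℝ) :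
    IsSpectrum r (fun ξ => Complex.exp (2 * Real.pi * Complex.I * b * ξ) * φ ξ) :=
  ⟨h.memLp.of_le ((by fun_prop : Continuous fun ξ : ℝ =>
      Complex.exp (2 * Real.pi * Complex.I * b * ξ)).aestronglyMeasurable.mul
      h.memLp.aestronglyMeasurable)
      (ae_of_all _ fun ξ => by rw [norm_mul, norm_exp_two_pi_mul, one_mul]),
    fun ξ hξ => by simp [h.eq_zero ξ hξ]⟩

theorem IsSpectrum.conj_neg {r : ℝ} {φ : ℝ → ℂ} (h : IsSpectrum r φ) :
    IsSpectrum r (fun ξ => conj (φ (-ξ))) :=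
  ⟨(h.memLp.comp_measurePreserving (Measure.measurePreserving_neg volume)).star,
    fun ξ hξ => by
      rw [h.eq_zero (-ξ) fun h' => hξ ⟨by linarith [h'.2], by linarith [h'.1]⟩, map_zero]⟩

/-- The convolution of two spectra is bounded, by `|φ ψ| ≤ |φ|² + |ψ|²` under the integral, and
integrable; hence it is square integrable. -/
theorem IsSpectrum.convolution {r s : ℝ} {φ ψ : ℝ → ℂ} (h : IsSpectrum r φ)
    (h' : IsSpectrum s ψ) :
    IsSpectrum (r + s) (MeasureTheory.convolution φ ψ (ContinuousLinearMap.mul ℂ ℂ) volume) := by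
  have hint := h.integrable.integrable_convolution (ContinuousLinearMap.mul ℂ ℂ) h'.integrable
  have hφ := (memLp_two_iff_integrable_sq_norm h.memLp.1).1 h.memLp
  have hψ := (memLp_two_iff_integrable_sq_norm h'.memLp.1).1 h'.memLp
  refine ⟨?_, fun ξ hξ => ?_⟩
  · rw [memLp_two_iff_integrable_sq_norm hint.1]
    have hb : ∀ x, ‖MeasureTheory.convolution φ ψ (ContinuousLinearMap.mul ℂ ℂ) volume x‖
        ≤ (∫ t, ‖φ t‖ ^ 2) + ∫ t, ‖ψ t‖ ^ 2 := by
      intro x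
      have hψ' := hψ.comp_sub_left x
      calc _ ≤ ∫ t, (‖φ t‖ ^ 2 + ‖ψ (x - t)‖ ^ 2) := by
            refine norm_integral_le_of_norm_le (hφ.add hψ') (ae_of_all _ fun t => ?_)
            rw [ContinuousLinearMap.mul_apply', norm_mul]
            nlinarith [sq_nonneg (‖φ t‖ - ‖ψ (x - t)‖), norm_nonneg (φ t),
              norm_nonneg (ψ (x - t)), mul_nonneg (norm_nonneg (φ t)) (norm_nonneg (ψ (x - t)))]
        _ = _ := by
            rw [integral_add hφ hψ', integral_sub_left_eq_self (fun t => ‖ψ t‖ ^ 2)]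
    simp_rw [pow_two (‖MeasureTheory.convolution φ ψ _ _ _‖)]
    exact hint.norm.bdd_mul hint.1.norm (ae_of_all _ fun x => (norm_norm _).trans_le (hb x))
  · refine integral_eq_zero_of_ae (ae_of_all _ fun t => ?_)
    change φ t * ψ (ξ - t) = 0
    by_cases ht : t ∈ Set.Icc (-r) r
    · rw [h'.eq_zero (ξ - t), mul_zero]
      exact fun hc => hξ ⟨by linarith [ht.1, hc.1], by linarith [ht.2, hc.2]⟩
    · rw [h.eq_zero t ht, zero_mul]

/-! ### Closure properties of Paley-Wiener spaces -/

section
variable {r s : ℝ} {f g : ℝ → ℂ}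

theorem paleyWiener_add (hf : f ∈ PaleyWiener (2 * Real.pi * r))
    (hg : g ∈ PaleyWiener (2 * Real.pi * r)) :
    (fun x => f x + g x) ∈ PaleyWiener (2 * Real.pi * r) := by
  obtain ⟨φ, hφ, rfl⟩ := mem_paleyWiener_iff.1 hf
  obtain ⟨ψ, hψ, rfl⟩ := mem_paleyWiener_iff.1 hg
  refine mem_paleyWiener_iff.2 ⟨_, hφ.add hψ, funext fun x => ?_⟩
  simp only [fourierInv_eq_integral_exp, Pi.add_apply, mul_add]
  rw [integral_add (integrable_exp_mul hφ.integrable x) (integrable_exp_mul hψ.integrable x)]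

theorem paleyWiener_const_mul (hf : f ∈ PaleyWiener (2 * Real.pi * r)) (c : ℂ) :
    (fun x => c * f x) ∈ PaleyWiener (2 * Real.pi * r) := by
  obtain ⟨φ, hφ, rfl⟩ := mem_paleyWiener_iff.1 hf
  refine mem_paleyWiener_iff.2 ⟨_, hφ.const_mul c, funext fun x => ?_⟩
  simp only [fourierInv_eq_integral_exp, mul_left_comm _ c]
  rw [integral_const_mul]

theorem paleyWiener_sub (hf : f ∈ PaleyWiener (2 * Real.pi * r))
    (hg : g ∈ PaleyWiener (2 * Real.pi * r)) :
    (fun x => f x - g x) ∈ PaleyWiener (2 * Real.pi * r) := by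
  simpa [sub_eq_add_neg] using paleyWiener_add hf (paleyWiener_const_mul hg (-1))

theorem paleyWiener_translate (hf : f ∈ PaleyWiener (2 * Real.pi * r)) (b : ℝ) :
    (fun x => f (x + b)) ∈ PaleyWiener (2 * Real.pi * r) := by
  obtain ⟨φ, hφ, rfl⟩ := mem_paleyWiener_iff.1 hf
  refine mem_paleyWiener_iff.2 ⟨_, hφ.modulate b, funext fun x => ?_⟩
  simp only [fourierInv_eq_integral_exp, ← mul_assoc, ← Complex.exp_add]
  push_cast
  simp only [mul_add, add_mul]

theorem paleyWiener_conj (hf : f ∈ PaleyWiener (2 * Real.pi * r)) :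
    (fun x => conj (f x)) ∈ PaleyWiener (2 * Real.pi * r) := by
  obtain ⟨φ, hφ, rfl⟩ := mem_paleyWiener_iff.1 hf
  refine mem_paleyWiener_iff.2 ⟨_, hφ.conj_neg, funext fun x => ?_⟩
  simp only [fourierInv_eq_integral_exp]
  rw [← integral_conj, ← integral_neg_eq_self]
  refine integral_congr_ae (ae_of_all _ fun ξ => ?_)
  simp [← Complex.exp_conj, Complex.conj_ofNat]

/-- Multiplying band-limited functions convolves their spectra, so the bandwidths add. -/
theorem paleyWiener_mul (hf : f ∈ PaleyWiener (2 * Real.pi * r))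
    (hg : g ∈ PaleyWiener (2 * Real.pi * s)) :
    (fun x => f x * g x) ∈ PaleyWiener (2 * Real.pi * (r + s)) := by
  obtain ⟨φ, hφ, rfl⟩ := mem_paleyWiener_iff.1 hf
  obtain ⟨ψ, hψ, rfl⟩ := mem_paleyWiener_iff.1 hg
  refine mem_paleyWiener_iff.2 ⟨_, hφ.convolution hψ, funext fun x => ?_⟩
  simp only [Real.fourierInv_eq_fourier_neg,
    Real.fourier_mul_convolution_eq hφ.integrable hψ.integrable]

theorem zero_mem_paleyWiener : (fun _ => 0 : ℝ → ℂ) ∈ PaleyWiener (2 * Real.pi * r) :=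
  mem_paleyWiener_iff.2 ⟨fun _ => 0, ⟨MemLp.zero', fun _ _ => rfl⟩, funext fun x => by
    simp [fourierInv_eq_integral_exp]⟩

theorem paleyWiener_sum {ι : Type*} (t : Finset ι) {F : ι → ℝ → ℂ}
    (hF : ∀ i, F i ∈ PaleyWiener (2 * Real.pi * r)) :
    (fun x => ∑ i ∈ t, F i x) ∈ PaleyWiener (2 * Real.pi * r) := by
  classical
  induction t using Finset.induction_on with
  | empty => simpa using zero_mem_paleyWiener
  | insert i t hi ih => simpa [Finset.sum_insert hi] using paleyWiener_add (hF i) ih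

theorem structuredConv_mem_paleyWiener {K : ℕ} (b : Fin K → ℝ) (v : Fin K → ℂ)
    (hf : f ∈ PaleyWiener (2 * Real.pi * r)) :
    structuredConv b v f ∈ PaleyWiener (2 * Real.pi * r) :=
  paleyWiener_sum _ fun k => paleyWiener_const_mul (paleyWiener_translate hf (b k)) _

/-! ### Analyticity and uniqueness -/

/-- Band-limited functions are real-analytic, being restrictions of the entire functions
`z ↦ ∫ φ ξ exp (2 π i z ξ) dξ`. -/
theorem analyticOnNhd_of_mem_paleyWiener (hf : f ∈ PaleyWiener (2 * Real.pi * r)) :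
    AnalyticOnNhd ℝ f Set.univ := by
  obtain ⟨φ, hφ, rfl⟩ := mem_paleyWiener_iff.1 hf
  -- The entire extension.
  let F : ℂ → ℂ := fun z => ∫ ξ : ℝ, Complex.exp (2 * Real.pi * Complex.I * z * ξ) * φ ξ
  have hbound : ∀ (z : ℂ) (ξ : ℝ), ξ ∈ Set.Icc (-r) r →
      ‖Complex.exp (2 * Real.pi * Complex.I * z * ξ)‖ ≤ Real.exp (2 * Real.pi * ‖z‖ * |r|) := by
    intro z ξ hξ
    have hξr : |ξ| ≤ |r| := (abs_le.2 hξ).trans (le_abs_self r)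
    refine (Complex.norm_exp_le_exp_norm _).trans (Real.exp_le_exp.2 ?_)
    simp only [norm_mul, Complex.norm_real, Complex.norm_I, Real.norm_eq_abs, Complex.norm_ofNat,
      abs_of_pos Real.pi_pos, mul_one]
    gcongr
  have hd : Differentiable ℂ F := by
    intro z₀
    refine (hasDerivAt_integral_of_dominated_loc_of_deriv_le
      (F := fun z (ξ : ℝ) => Complex.exp (2 * Real.pi * Complex.I * z * ξ) * φ ξ)
      (F' := fun z (ξ : ℝ) => Complex.exp (2 * Real.pi * Complex.I * z * ξ) *
        (2 * Real.pi * Complex.I * ξ) * φ ξ)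
      (bound := fun ξ => Real.exp (2 * Real.pi * (‖z₀‖ + 1) * |r|) * (2 * Real.pi * |r|) * ‖φ ξ‖)
      (Metric.ball_mem_nhds z₀ one_pos) ?_ ?_ ?_ ?_ ?_ ?_).2.differentiableAt
    · exact Eventually.of_forall fun z =>
        (by fun_prop : Continuous fun ξ : ℝ => Complex.exp (2 * Real.pi * Complex.I * z * ξ))
          |>.aestronglyMeasurable.mul hφ.memLp.1
    · refine (hφ.integrable.norm.const_mul (Real.exp (2 * Real.pi * ‖z₀‖ * |r|))).mono'
        ((by fun_prop : Continuous fun ξ : ℝ => Complex.exp (2 * Real.pi * Complex.I * z₀ * ξ))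
          |>.aestronglyMeasurable.mul hφ.memLp.1) (ae_of_all _ fun ξ => ?_)
      by_cases hξ : ξ ∈ Set.Icc (-r) r
      · rw [norm_mul]; gcongr; exact hbound z₀ ξ hξ
      · simp [hφ.eq_zero ξ hξ]
    · exact (by fun_prop : Continuous fun ξ : ℝ => Complex.exp (2 * Real.pi * Complex.I * z₀ * ξ) *
        (2 * Real.pi * Complex.I * ξ)).aestronglyMeasurable.mul hφ.memLp.1
    · refine ae_of_all _ fun ξ z hz => ?_
      by_cases hξ : ξ ∈ Set.Icc (-r) r
      · have hξr : |ξ| ≤ |r| := (abs_le.2 hξ).trans (le_abs_self r)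
        have hz' : ‖z‖ ≤ ‖z₀‖ + 1 := by
          have h1 := norm_le_norm_add_norm_sub z₀ z
          rw [Metric.mem_ball, dist_eq_norm] at hz
          rw [norm_sub_rev] at h1
          linarith [norm_sub_rev z z₀]
        have h2 : ‖(2 * Real.pi * Complex.I * ξ : ℂ)‖ ≤ 2 * Real.pi * |r| := by
          simp only [norm_mul, Complex.norm_real, Complex.norm_I, Real.norm_eq_abs,
            Complex.norm_ofNat, abs_of_pos Real.pi_pos, mul_one]
          gcongr
        rw [norm_mul, norm_mul]
        gcongr
        exact (hbound z ξ hξ).trans (Real.exp_le_exp.2 (by gcongr))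
      · simp [hφ.eq_zero ξ hξ]
    · exact hφ.integrable.norm.const_mul _
    · refine ae_of_all _ fun ξ z _ => ?_
      have h1 : HasDerivAt (fun z : ℂ => 2 * Real.pi * Complex.I * z * ξ)
          (2 * Real.pi * Complex.I * ξ) z := by
        simpa using ((hasDerivAt_id z).const_mul (2 * Real.pi * Complex.I)).mul_const (ξ : ℂ)
      exact h1.cexp.mul_const (φ ξ)
  intro x _
  have hFx : AnalyticAt ℝ F (x : ℂ) := (hd.analyticAt (x : ℂ)).restrictScalars
  have h2 : AnalyticAt ℝ (fun y : ℝ => F (y : ℂ)) x :=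
    AnalyticAt.fun_comp (g := F) (f := fun y : ℝ => (y : ℂ)) hFx (Complex.ofRealCLM.analyticAt x)
  convert h2 using 1
  exact funext fun y => fourierInv_eq_integral_exp φ y

/-- A progression `aℤ` denser than the Nyquist rate `2r` is a uniqueness set: the values at `n a`
are, up to a factor, the Fourier coefficients of the spectrum on a period of length `1 / a > 2r`,
which contains its support. -/
theorem eq_zero_of_eq_zero_on_int_mul {a : ℝ} (ha : 0 < a) (har : 2 * r * a < 1)
    (hf : f ∈ PaleyWiener (2 * Real.pi * r)) (h0 : ∀ n : ℤ, f (n * a) = 0) (x : ℝ) : f x = 0 := by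
  obtain ⟨φ, hφ, rfl⟩ := mem_paleyWiener_iff.1 hf
  have hra : r < 1 / (2 * a) := by rw [lt_div_iff₀ (by positivity)]; linarith
  have hlt : -(1 / (2 * a)) < 1 / (2 * a) := by
    have : 0 < 1 / (2 * a) := by positivity
    linarith
  have hT : 1 / (2 * a) - -(1 / (2 * a)) = 1 / a := by field_simp; ring
  have hsupp : ∀ ξ, ξ ∉ Set.Ioc (-(1 / (2 * a))) (1 / (2 * a)) → φ ξ = 0 := fun ξ hξ =>
    hφ.eq_zero ξ fun h => hξ ⟨by linarith [h.1], by linarith [h.2]⟩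
  have hcoef : ∀ n : ℤ, fourierCoeffOn hlt φ n = 0 := by
    intro n
    rw [fourierCoeffOn_eq_integral, intervalIntegral.integral_of_le hlt.le,
      setIntegral_eq_integral_of_forall_compl_eq_zero fun ξ hξ => by rw [hsupp ξ hξ, smul_zero]]
    -- The `n`-th Fourier coefficient has the kernel `exp (-2 π i n a ξ)`.
    have h1 := h0 (-n)
    rw [fourierInv_eq_integral_exp] at h1
    rw [hT, smul_eq_zero]
    right
    rw [← h1]
    refine integral_congr_ae (ae_of_all _ fun ξ => ?_)
    simp only [fourier_coe_apply, smul_eq_mul]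
    congr 2
    push_cast
    field_simp
  have hpars := hasSum_sq_fourierCoeffOn hlt (hφ.memLp.restrict _)
  simp only [hcoef, norm_zero, ne_eq, OfNat.ofNat_ne_zero, not_false_eq_true, zero_pow] at hpars
  have hz := hpars.unique hasSum_zero
  rw [intervalIntegral.integral_of_le hlt.le, setIntegral_eq_integral_of_forall_compl_eq_zero
    (fun ξ hξ => by rw [hsupp ξ hξ]; simp), hT, smul_eq_zero] at hz
  have hz' := hz.resolve_left (by positivity)
  rw [integral_eq_zero_iff_of_nonneg (fun _ => by positivity)
    ((memLp_two_iff_integrable_sq_norm hφ.memLp.1).1 hφ.memLp)] at hz'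
  rw [fourierInv_eq_integral_exp]
  refine integral_eq_zero_of_ae ?_
  filter_upwards [hz'] with ξ hξ
  have : φ ξ = 0 := by simpa using hξ
  simp [this]
end

/-! ### From samples to the line -/

/-- Phaseless samples on a sampling set for `PW_{2π}` determine the modulus of a function in `PW_π`,
since `|F|² - |G|²` belongs to `PW_{2π}`. -/
theorem norm_eq_of_norm_eq_on_sampling {t : ℤ → ℝ} (ht : IsSetOfSampling (2 * Real.pi) t)
    {F G : ℝ → ℂ} (hF : F ∈ PaleyWiener Real.pi) (hG : G ∈ PaleyWiener Real.pi)
    (h : ∀ n, ‖F (t n)‖ = ‖G (t n)‖) (x : ℝ) : ‖F x‖ = ‖G x‖ := by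
  obtain ⟨A, B, hA, -, hs⟩ := ht
  have e1 : Real.pi = 2 * Real.pi * (1 / 2) := by ring
  have e2 : 2 * Real.pi = 2 * Real.pi * (1 / 2 + 1 / 2) := by ring
  rw [e1] at hF hG
  have hH := paleyWiener_sub (paleyWiener_mul hF (paleyWiener_conj hF))
    (paleyWiener_mul hG (paleyWiener_conj hG))
  rw [← e2] at hH
  have hval : ∀ y, F y * conj (F y) - G y * conj (G y) = ((‖F y‖ ^ 2 - ‖G y‖ ^ 2 : ℝ) : ℂ) := by
    intro y
    rw [Complex.mul_conj', Complex.mul_conj']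
    push_cast
    ring
  simp only [hval] at hH
  have h1 := (hs _ hH).2.1
  simp only [h, sub_self, Complex.ofReal_zero, norm_zero, ne_eq, OfNat.ofNat_ne_zero,
    not_false_eq_true, zero_pow, tsum_zero] at h1
  obtain ⟨hc, hL, -⟩ := hH
  have h2 := le_antisymm (nonpos_of_mul_nonpos_right h1 hA)
    (integral_nonneg fun _ => by positivity)
  rw [integral_eq_zero_iff_of_nonneg (fun _ => by positivity)
    ((memLp_two_iff_integrable_sq_norm hL.1).1 hL)] at h2
  have h3 := congrFun ((Continuous.ae_eq_iff_eq volume (hc.norm.pow 2) continuous_zero).1 h2) x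
  simp only [Pi.pow_apply, Pi.zero_apply, ne_eq, OfNat.ofNat_ne_zero, not_false_eq_true,
    pow_eq_zero_iff, norm_eq_zero, Complex.ofReal_eq_zero, sub_eq_zero] at h3
  exact (sq_eq_sq₀ (norm_nonneg _) (norm_nonneg _)).1 h3

/-! ### Periods of the quotient -/

theorem analyticOnNhd_translate {u : ℝ → ℂ} (hu : AnalyticOnNhd ℝ u Set.univ) (c : ℝ) :
    AnalyticOnNhd ℝ (fun x => u (x + c)) Set.univ := fun x _ =>
  AnalyticAt.fun_comp (hu (x + c) trivial) (analyticAt_id.add analyticAt_const)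

/-- If at every point the vector of translates of `f` is, up to phase, that of `g` or of `conj g`,
then one of the two alternatives for the phase-invariant products holds on the whole line: a product
of two real-analytic functions vanishes only if one factor does. -/
theorem translate_products_dichotomy {K : ℕ} {b : Fin K → ℝ} {f g : ℝ → ℂ}
    (hf : AnalyticOnNhd ℝ f Set.univ) (hg : AnalyticOnNhd ℝ g Set.univ)
    (h : ∀ x : ℝ, ∃ θ : ℝ, (∀ k, f (x + b k) = Complex.exp (θ * Complex.I) * g (x + b k)) ∨
      (∀ k, f (x + b k) = Complex.exp (θ * Complex.I) * conj (g (x + b k)))) :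
    (∀ x j k, f (x + b j) * conj (f (x + b k)) = g (x + b j) * conj (g (x + b k))) ∨
    (∀ x j k, f (x + b j) * conj (f (x + b k)) = conj (g (x + b j)) * g (x + b k)) := by
  have hcj : ∀ {u : ℝ → ℂ}, AnalyticOnNhd ℝ u Set.univ →
      AnalyticOnNhd ℝ (fun x => conj (u x)) Set.univ := fun {u} hu x _ =>
    AnalyticAt.fun_comp (Complex.conjCLE.toContinuousLinearMap.analyticAt (u x)) (hu x trivial)
  have hpt : ∀ x,
      (∀ j k, f (x + b j) * conj (f (x + b k)) = g (x + b j) * conj (g (x + b k))) ∨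
      (∀ j k, f (x + b j) * conj (f (x + b k)) = conj (g (x + b j)) * g (x + b k)) := by
    intro x
    obtain ⟨θ, hθ⟩ := h x
    have hu : Complex.exp (θ * Complex.I) * conj (Complex.exp (θ * Complex.I)) = 1 := by
      rw [Complex.mul_conj', Complex.norm_exp_ofReal_mul_I]; simp
    refine hθ.imp (fun h j k => ?_) (fun h j k => ?_)
    · rw [h j, h k, map_mul]
      linear_combination (g (x + b j) * conj (g (x + b k))) * hu
    · rw [h j, h k, map_mul, Complex.conj_conj]
      linear_combination (conj (g (x + b j)) * g (x + b k)) * hu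
  by_contra! hcon
  obtain ⟨⟨x₁, j₁, k₁, h₁⟩, x₂, j₂, k₂, h₂⟩ := hcon
  have hff : ∀ j k, AnalyticOnNhd ℝ (fun x => f (x + b j) * conj (f (x + b k))) Set.univ :=
    fun j k => (analyticOnNhd_translate hf _).mul (hcj (analyticOnNhd_translate hf _))
  have hp₁ := (hff j₁ k₁).sub
    ((analyticOnNhd_translate hg (b j₁)).mul (hcj (analyticOnNhd_translate hg (b k₁))))
  have hp₂ := (hff j₂ k₂).sub
    ((hcj (analyticOnNhd_translate hg (b j₂))).mul (analyticOnNhd_translate hg (b k₂)))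
  -- At every point one of the two identities holds, so the product of defects is zero.
  rcases hp₁.eq_zero_or_eq_zero_of_mul_eq_zero hp₂ (fun x _ => by
      rcases hpt x with h | h
      · simp [h j₁ k₁]
      · simp [h j₂ k₂]) isPreconnected_univ with h | h
  · exact h₁ (sub_eq_zero.1 (h x₁ trivial))
  · exact h₂ (sub_eq_zero.1 (h x₂ trivial))

/-- The real periods of the meromorphic function `f / g`, with the condition
`f (x + s) / g (x + s) = f x / g x` written without denominators. Analyticity is what makes
them closed under addition, as `g` may vanish at the intermediate point. -/
def quotientPeriods {f g : ℝ → ℂ} (hf : AnalyticOnNhd ℝ f Set.univ)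
    (hg : AnalyticOnNhd ℝ g Set.univ) (hg0 : ∃ x, g x ≠ 0) : AddSubgroup ℝ where
  carrier := {s | ∀ x, f (x + s) * g x = g (x + s) * f x}
  zero_mem' := fun x => by simp [mul_comm]
  neg_mem' := fun {s} hs x => by
    have := hs (x + -s)
    rw [neg_add_cancel_right] at this
    linear_combination -this
  add_mem' := fun {s u} hs hu => by
    have hd := ((analyticOnNhd_translate hf (s + u)).mul hg).sub
      ((analyticOnNhd_translate hg (s + u)).mul hf)
    rcases (analyticOnNhd_translate hg s).eq_zero_or_eq_zero_of_mul_eq_zero hd (fun x _ => by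
        have h1 := hs x
        have h2 := hu (x + s)
        simp only [Pi.sub_apply, ← add_assoc]
        linear_combination g x * h2 + g (x + s + u) * h1) isPreconnected_univ with h | h
    · obtain ⟨x, hx⟩ := hg0
      exact absurd (by simpa using h (x - s) trivial) hx
    · exact fun x => sub_eq_zero.1 (h x trivial)

/-! ### Density and constancy of the quotient -/

/-- A subgroup of density above `1` has an element in `(0, 1)`: otherwise distinct elements are at
distance at least `1`, and an interval of length `h` contains at most `h + 1` of them. -/
theorem exists_mem_Ioo_of_one_lt_density {Γ : AddSubgroup ℝ} {D : ℝ≥0∞} (hD : 1 < D)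
    (h : HasBeurlingDensity (Γ : Set ℝ) D) :
    ∃ a ∈ Γ, 0 < a ∧ a < 1 := by
  by_contra! hsep
  refine absurd (le_of_tendsto_of_tendsto h (b := atTop) (g := fun h : ℝ => 1 + ENNReal.ofReal h⁻¹)
    (a₂ := 1) ?_ ?_) (not_le.2 hD)
  · have := (ENNReal.tendsto_ofReal tendsto_inv_atTop_zero).const_add 1
    simpa using this
  · filter_upwards [eventually_gt_atTop 0] with r hr
    have hcard : ((Γ : Set ℝ) ∩ Set.Icc 0 (0 + r)).encard ≤ (⌊r⌋₊ + 1 : ℕ) := by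
      -- Elements at distance at least `1` have different integer parts.
      have hinj : Set.InjOn (fun y : ℝ => ⌊y⌋₊) ((Γ : Set ℝ) ∩ Set.Icc 0 (0 + r)) := by
        intro y hy z hz hyz
        by_contra hne
        have hy1 := Nat.floor_le hy.2.1
        have hy2 := Nat.lt_floor_add_one y
        have hz1 := Nat.floor_le hz.2.1
        have hz2 := Nat.lt_floor_add_one z
        simp only at hyz
        rw [hyz] at hy1 hy2
        rcases lt_or_gt_of_ne hne with hlt | hlt
        · linarith [hsep _ (Γ.sub_mem hz.1 hy.1) (sub_pos.2 hlt)]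
        · linarith [hsep _ (Γ.sub_mem hy.1 hz.1) (sub_pos.2 hlt)]
      rw [← hinj.encard_image]
      calc _ ≤ ((Finset.range (⌊r⌋₊ + 1) : Finset ℕ) : Set ℕ).encard := by
            refine Set.encard_le_encard ?_
            rintro _ ⟨y, hy, rfl⟩
            rw [Finset.mem_coe, Finset.mem_range, Nat.lt_succ_iff]
            exact Nat.floor_le_floor (by simpa using hy.2.2)
        _ = _ := by rw [Set.encard_coe_eq_coe_finsetCard, Finset.card_range]
    refine ENNReal.div_le_of_le_mul ((iInf_le _ 0).trans ?_)
    calc (((Γ : Set ℝ) ∩ Set.Icc 0 (0 + r)).encard : ℝ≥0∞) ≤ (((⌊r⌋₊ + 1 : ℕ) : ℕ∞) : ℝ≥0∞) := by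
          exact_mod_cast hcard
      _ = ENNReal.ofReal ((⌊r⌋₊ : ℝ) + 1) := by
          rw [ENat.toENNReal_coe, ← ENNReal.ofReal_natCast]; push_cast; rfl
      _ ≤ ENNReal.ofReal ((1 + r⁻¹) * r) := by
          refine ENNReal.ofReal_le_ofReal ?_
          rw [add_mul, inv_mul_cancel₀ hr.ne', one_mul]
          linarith [Nat.floor_le hr.le]
      _ = _ := by
          rw [ENNReal.ofReal_mul (by positivity), ENNReal.ofReal_add one_pos.le (by positivity),
            ENNReal.ofReal_one]

/-- If `f / g` has unimodular values and enough periods, it is constant: for `g x₀ ≠ 0`, the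
function `g x₀ * f - f x₀ * g` in `PW_π` vanishes on a translate of `aℤ` with `a < 1`, hence
identically. -/
theorem exists_unimodular_eq_mul {f g : ℝ → ℂ} (hf : f ∈ PaleyWiener Real.pi)
    (hg : g ∈ PaleyWiener Real.pi) (hn : ∀ x, ‖f x‖ = ‖g x‖) {Γ : AddSubgroup ℝ}
    (hΓ : ∃ a ∈ Γ, 0 < a ∧ a < 1) {S : Set ℝ}
    (hS : Γ = AddSubgroup.closure S) (hper : ∀ s ∈ S, ∀ x, f (x + s) * g x = g (x + s) * f x) :
    ∃ c : ℂ, ‖c‖ = 1 ∧ ∀ x, f x = c * g x := by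
  by_cases hg0 : ∃ x, g x ≠ 0
  swap
  · push Not at hg0
    exact ⟨1, norm_one, fun x => by rw [hg0, mul_zero, ← norm_eq_zero, hn, hg0, norm_zero]⟩
  have e1 : Real.pi = 2 * Real.pi * (1 / 2) := by ring
  rw [e1] at hf hg
  have hfa := analyticOnNhd_of_mem_paleyWiener hf
  have hga := analyticOnNhd_of_mem_paleyWiener hg
  have hle : Γ ≤ quotientPeriods hfa hga hg0 := hS ▸ (AddSubgroup.closure_le _).2 hper
  obtain ⟨x₀, hx₀⟩ := hg0
  have hφ := paleyWiener_sub (paleyWiener_const_mul (paleyWiener_translate hf x₀) (g x₀))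
    (paleyWiener_const_mul (paleyWiener_translate hg x₀) (f x₀))
  have hφ0 : ∀ s ∈ Γ, g x₀ * f (s + x₀) - f x₀ * g (s + x₀) = 0 := fun s hs => by
    have := hle hs x₀
    rw [add_comm s]
    linear_combination this
  have hz : ∀ y, g x₀ * f (y + x₀) - f x₀ * g (y + x₀) = 0 := by
    obtain ⟨a, haΓ, ha, ha1⟩ := hΓ
    refine eq_zero_of_eq_zero_on_int_mul ha (by linarith) hφ fun n => hφ0 _ ?_
    rw [← zsmul_eq_mul]
    exact Γ.zsmul_mem haΓ n
  refine ⟨f x₀ / g x₀, by rw [norm_div, hn, div_self (norm_ne_zero_iff.2 hx₀)], fun x => ?_⟩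
  have := hz (x - x₀)
  rw [sub_add_cancel] at this
  field_simp
  linear_combination this

/-- The differences of the shifts are periods of `f / g` (in the form without denominators). -/
theorem cross_mul_eq_of_products_eq {K : ℕ} {b : Fin K → ℝ} {f g : ℝ → ℂ}
    (hn : ∀ x, ‖f x‖ = ‖g x‖)
    (h : ∀ x j k, f (x + b j) * conj (f (x + b k)) = g (x + b j) * conj (g (x + b k)))
    (j k : Fin K) (x : ℝ) :
    f (x + (b j - b k)) * g x = g (x + (b j - b k)) * f x := by
  have h1 := h (x - b k) j k
  rw [sub_add_cancel, show x - b k + b j = x + (b j - b k) by ring] at h1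
  by_cases hx : g x = 0
  · have : f x = 0 := by rw [← norm_eq_zero, hn, hx, norm_zero]
    rw [hx, this, mul_zero, mul_zero]
  · have hff : f x * conj (f x) = g x * conj (g x) := by
      rw [Complex.mul_conj', Complex.mul_conj', hn]
    refine mul_right_cancel₀ (b := conj (g x)) (by simpa using hx) ?_
    linear_combination f x * h1 - f (x + (b j - b k)) * hff

/-! ### Conjugate phase retrieval from structured convolutions -/

theorem mainTheorem1 {K M : ℕ} (V : Matrix (Fin K) (Fin M) ℂ) (hV : DoesConjPhaseRetrieval V)
    (b : Fin K → ℝ) (D : ℝ≥0∞) (hD : 1 < D)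
    (hb : HasBeurlingDensity
      (AddSubgroup.closure (Set.range fun p : Fin K × Fin K => b p.1 - b p.2) : Set ℝ) D)
    (t : ℤ → ℝ) (ht : IsSetOfSampling (2 * Real.pi) t)
    (f g : ℝ → ℂ) (hf : f ∈ PaleyWiener Real.pi) (hg : g ∈ PaleyWiener Real.pi)
    (hfg : ∀ (m : Fin M) (n : ℤ),
      ‖structuredConv b (fun k => V k m) f (t n)‖ = ‖structuredConv b (fun k => V k m) g (t n)‖) :
    ConjEquiv f g := by
  have hΓ := exists_mem_Ioo_of_one_lt_density hD hb
  -- Without shifts the difference group is trivial, which its density excludes.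
  have hK : Nonempty (Fin K) := by
    by_contra hE
    rw [not_nonempty_iff] at hE
    rw [Set.range_eq_empty, AddSubgroup.closure_empty] at hΓ
    obtain ⟨a, ha, ha0, -⟩ := hΓ
    exact ha0.ne' ha
  obtain ⟨k₀⟩ := hK
  have e1 : Real.pi = 2 * Real.pi * (1 / 2) := by ring
  have hf' := e1 ▸ hf
  have hg' := e1 ▸ hg
  have hconv : ∀ (m : Fin M) (x : ℝ), ‖structuredConv b (fun k => V k m) f x‖ =
      ‖structuredConv b (fun k => V k m) g x‖ := fun m =>
    norm_eq_of_norm_eq_on_sampling ht (e1 ▸ structuredConv_mem_paleyWiener b _ hf')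
      (e1 ▸ structuredConv_mem_paleyWiener b _ hg') (hfg m)
  have hpt := fun x : ℝ => hV (fun k => f (x + b k)) (fun k => g (x + b k)) fun m => hconv m x
  have hn : ∀ x, ‖f x‖ = ‖g x‖ := by
    intro x
    obtain ⟨θ, h | h⟩ := hpt (x - b k₀)
    · simpa [Complex.norm_exp_ofReal_mul_I] using congrArg norm (h k₀)
    · simpa [Complex.norm_exp_ofReal_mul_I] using congrArg norm (h k₀)
  rcases translate_products_dichotomy (analyticOnNhd_of_mem_paleyWiener hf')
    (analyticOnNhd_of_mem_paleyWiener hg') hpt with h | h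
  · obtain ⟨c, hc, hcf⟩ := exists_unimodular_eq_mul hf hg hn hΓ rfl (by
      rintro _ ⟨⟨j, k⟩, rfl⟩ x
      exact cross_mul_eq_of_products_eq hn h j k x)
    exact ⟨c, hc, Or.inl hcf⟩
  · obtain ⟨c, hc, hcf⟩ := exists_unimodular_eq_mul (g := fun x => conj (g x)) hf
      (e1 ▸ paleyWiener_conj hg') (fun x => by rw [hn, RCLike.norm_conj]) hΓ rfl (by
      rintro _ ⟨⟨j, k⟩, rfl⟩ x
      exact cross_mul_eq_of_products_eq (g := fun x => conj (g x))
        (fun x => by rw [hn, RCLike.norm_conj])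
        (fun x j k => by rw [Complex.conj_conj]; exact h x j k) j k x)
    exact ⟨c, hc, Or.inr hcf⟩
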